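/- Surveyor's formula. Let $P$ be a lattice Jordan polygon in the plane with the square lattice $\mathbb Z^2$, given by the cyclic list $(m_1,n_1),\dots,(m_N,n_N)$ of the lattice points on its boundary, listed counterclockwise. That is: $N\ge 3$; the points are pairwise distinct; each side from $(m_i,n_i)$ to $(m_{i+1},n_{i+1})$ (indices modulo $N$) contains no lattice points other than its two distinct endpoints; different sides have no common internal point; and when one moves along any side in the direction of increasing index, the points enclosed by the polygon (those in bounded components of the complement of the boundary) lie immediately to the left. Let $A(P)$ be the area (Lebesgue measure) of the region consisting of the boundary and the enclosed points. Then $A(P)$ is finite and $$A(P)=\frac12\sum_{i=1}^{N}\begin{vmatrix} m_i & n_i\\ m_{i+1} & n_{i+1}\end{vmatrix},\qquad (m_{N+1},n_{N+1})=(m_1,n_1).$$ Call $(m_i,n_i)$ a vertex if the vectors $(m_i-m_{i-1},n_i-n_{i-1})$ and $(m_{i+1}-m_i,n_{i+1}-n_i)$ do not have the same direction. The formula remains true when any of the points that are not vertices are deleted from the list, the remaining points being kept in the same cyclic order. In particular, if $(x_1,y_1),\dots,(x_k,y_k)$ are the vertices in this order and $(x_{k+1},y_{k+1})=(x_1,y_1)$,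 then $$A(P)=\frac12\sum_{j=1}^{k}\begin{vmatrix} x_j & y_j\\ x_{j+1} & y_{j+1}\end{vmatrix}.$$ -/

import Mathlib

open MeasureTheory Topology

namespace LatticePolygon

/-- The lattice point `(m, n)` as a point of the plane. -/
def toPlane (q : ℤ × ℤ) : ℝ × ℝ := ((q.1 : ℝ), (q.2 : ℝ))

/-- The oriented segment from `a` to `b` is a simple lattice vector: it is nonzero and passes through
no lattice points other than its two ends. -/
def IsSimpleVector (a b : ℤ × ℤ) : Prop :=
  a ≠ b ∧ ∀ q : ℤ × ℤ, toPlane q ∈ segment ℝ (toPlane a) (toPlane b) → q = a ∨ q = b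

/-- The closed polygonal line through the lattice points `P i`, drawn in the real plane.
The cyclic successor of the index `i` is `finRotate N i`. -/
def toReal {N : ℕ} (P : Polygon (ℤ × ℤ) N) : Polygon (ℝ × ℝ) N := ⟨fun i => toPlane (P i)⟩

/-- `P` lists the successive lattice points of a lattice Jordan polygon (a closed simple path of simple
lattice vectors): consecutive points are joined by simple lattice vectors, every point is visited
once, and different sides have no common internal point. -/
structure IsJordan {N : ℕ} (P : Polygon (ℤ × ℤ) N) : Prop where
  three_le : 3 ≤ N
  simple : ∀ i, IsSimpleVector (P i) (P (finRotate N i))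
  injective : Function.Injective P.vertices
  disjoint : ∀ i j, i ≠ j →
    Disjoint (openSegment ℝ (toReal P i) (toReal P (finRotate N i)))
      (openSegment ℝ (toReal P j) (toReal P (finRotate N j)))

/-- The points enclosed by the polygon but not lying on it: those in the bounded connected components
of the complement of the boundary. -/
def enclosed {N : ℕ} (P : Polygon (ℤ × ℤ) N) : Set (ℝ × ℝ) :=
  {z | z ∉ (toReal P).boundary ℝ ∧
    Bornology.IsBounded (connectedComponentIn ((toReal P).boundary ℝ)ᶜ z)}

/-- The plane region of the polygon: its boundary together with the enclosed points. -/
def region {N : ℕ} (P : Polygon (ℤ × ℤ) N) : Set (ℝ × ℝ) :=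
  (toReal P).boundary ℝ ∪ enclosed P

/-- The vector `v` turned by a right angle to the left. -/
def turnLeft (v : ℝ × ℝ) : ℝ × ℝ := (-v.2, v.1)

/-- The boundary is traversed counterclockwise: when one moves along any side, the enclosed
points are immediately to the left. -/
def IsCounterclockwise {N : ℕ} (P : Polygon (ℤ × ℤ) N) : Prop :=
  ∀ i : Fin N, ∀ z ∈ openSegment ℝ (toReal P i) (toReal P (finRotate N i)),
    ∀ᶠ ε in 𝓝[>] (0 : ℝ),
      z + ε • turnLeft (toReal P (finRotate N i) - toReal P i) ∈ enclosed P

/-- The lattice point with index `i` is a vertex: the direction of the path changes there. -/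
def IsVertex {N : ℕ} (P : Polygon (ℤ × ℤ) N) (i : Fin N) : Prop :=
  ¬ SameRay ℤ (P i - P ((finRotate N).symm i)) (P (finRotate N i) - P i)

open Classical in
/-- The indices of the vertices. -/
noncomputable def vertexIndices {N : ℕ} (P : Polygon (ℤ × ℤ) N) : Finset (Fin N) :=
  Finset.univ.filter (IsVertex P)

/-- Keep only the points with index in `S`, in the same cyclic order. -/
def restrict {N : ℕ} (P : Polygon (ℤ × ℤ) N) (S : Finset (Fin N)) : Polygon (ℤ × ℤ) S.card :=
  ⟨fun j => P (S.orderEmbOfFin rfl j)⟩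

/-- The cyclic sum `∑ det [[mᵢ, nᵢ], [mᵢ₊₁, nᵢ₊₁]]`. -/
def surveyorSum {N : ℕ} (P : Polygon (ℤ × ℤ) N) : ℤ :=
  ∑ i : Fin N, Matrix.det !![(P i).1, (P i).2; (P (finRotate N i)).1, (P (finRotate N i)).2]

end LatticePolygon

namespace LatticePolygon

/-! Cut the region by vertical lines and integrate the lengths of the slices. A line that avoids all
listed points meets the boundary in finitely many interior points of sides, and along it membership
in `enclosed P` can change only there. If every side has enclosed points on its left and none on its
right, the change at a crossing is +1 (upwards) on a side running to the right and -1 on a side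
running to the left. The slice therefore has length `∑ sgn * (M - height)` for any large `M`;
integrating over the abscissa turns each side into a signed trapezoid, and the trapezoids sum
cyclically to half the determinants (`volume_region`).

The hypothesis speaks only of the left of each side. That the right is not enclosed is the
topological core, and it replaces the Jordan curve theorem: if the right of one side were enclosed,
a small sector at each corner would carry this to the next side, hence to all sides
(`IsJordan.rightEnclosed_finRotate`). Then the points just above the highest side over some abscissa
would be enclosed, although they lie on a vertical ray that goes to infinity off the boundary
(`not_rightEnclosed`).

Deleting points that are not vertices is pure algebra: along collinear points the determinants add
up to the determinant of the two ends (`sum_intCross_of_parallel`). -/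

variable {N : ℕ} {P : Polygon (ℤ × ℤ) N}

/-! ### Sides, boundary and enclosed set: first properties -/

/-- The planar cross product. -/
def cross (u v : ℝ × ℝ) : ℝ := u.1 * v.2 - u.2 * v.1

lemma cross_add_right (u v w : ℝ × ℝ) : cross u (v + w) = cross u v + cross u w := by
  simp only [cross, Prod.fst_add, Prod.snd_add]; ring

lemma cross_smul_right (c : ℝ) (u v : ℝ × ℝ) : cross u (c • v) = c * cross u v := by
  simp only [cross, Prod.smul_fst, Prod.smul_snd, smul_eq_mul]; ring


/-- The direction vector of a side. -/
def dir (P : Polygon (ℤ × ℤ) N) (i : Fin N) : ℝ × ℝ :=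
  toReal P (finRotate N i) - toReal P i

lemma toPlane_injective : Function.Injective toPlane := by
  rintro ⟨a, b⟩ ⟨c, d⟩ h
  simpa [toPlane] using h

lemma edgeSet_eq (i : Fin N) :
    (toReal P).edgeSet ℝ i = segment ℝ (toReal P i) (toReal P (finRotate N i)) := by
  rw [Polygon.edgeSet, affineSegment_eq_segment]

lemma mem_boundary {z : ℝ × ℝ} :
    z ∈ (toReal P).boundary ℝ ↔ ∃ i, z ∈ segment ℝ (toReal P i) (toReal P (finRotate N i)) := by
  simp [Polygon.boundary, edgeSet_eq]

lemma isClosed_segment (a b : ℝ × ℝ) : IsClosed (segment ℝ a b) := by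
  rw [← convexHull_pair]
  exact ((Set.finite_singleton b).insert a).isClosed_convexHull ℝ

lemma isClosed_boundary (P : Polygon (ℤ × ℤ) N) : IsClosed ((toReal P).boundary ℝ) := by
  simp only [Polygon.boundary, edgeSet_eq]
  exact isClosed_iUnion_of_finite fun i => isClosed_segment _ _

lemma IsPreconnected.subset_enclosed {T : Set (ℝ × ℝ)} (hT : IsPreconnected T)
    (hTB : ∀ z ∈ T, z ∉ (toReal P).boundary ℝ) {z : ℝ × ℝ} (hz : z ∈ T) (hzE : z ∈ enclosed P) :
    T ⊆ enclosed P := by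
  intro w hw
  refine ⟨hTB w hw, ?_⟩
  have h := hT.subset_connectedComponentIn hz (F := ((toReal P).boundary ℝ)ᶜ) hTB hw
  rw [← connectedComponentIn_eq h]
  exact hzE.2

lemma not_mem_enclosed_of_unbounded {T : Set (ℝ × ℝ)} (hT : IsPreconnected T)
    (hTB : ∀ z ∈ T, z ∉ (toReal P).boundary ℝ) (hub : ¬ Bornology.IsBounded T) {z : ℝ × ℝ}
    (hz : z ∈ T) : z ∉ enclosed P := fun hzE =>
  hub (hzE.2.subset (hT.subset_connectedComponentIn hz hTB))

lemma isOpen_enclosed (P : Polygon (ℤ × ℤ) N) : IsOpen (enclosed P) := by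
  rw [isOpen_iff_mem_nhds]
  intro z hz
  have ho : IsOpen ((toReal P).boundary ℝ)ᶜ := (isClosed_boundary P).isOpen_compl
  refine Filter.mem_of_superset
    (ho.connectedComponentIn.mem_nhds (mem_connectedComponentIn hz.1)) ?_
  exact IsPreconnected.subset_enclosed isPreconnected_connectedComponentIn
    (fun w hw => connectedComponentIn_subset _ _ hw) (mem_connectedComponentIn hz.1) hz

lemma measurableSet_region (P : Polygon (ℤ × ℤ) N) : MeasurableSet (region P) :=
  (isClosed_boundary P).measurableSet.union (isOpen_enclosed P).measurableSet

lemma IsJordan.toReal_ne (hP : IsJordan P) (i : Fin N) :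
    toReal P i ≠ toReal P (finRotate N i) := fun h =>
  (hP.simple i).1 (toPlane_injective h)

lemma IsJordan.dir_ne_zero (hP : IsJordan P) (i : Fin N) : dir P i ≠ 0 :=
  sub_ne_zero.2 (hP.toReal_ne i).symm

lemma IsJordan.vertex_mem (hP : IsJordan P) {i j : Fin N}
    (h : toReal P i ∈ segment ℝ (toReal P j) (toReal P (finRotate N j))) :
    i = j ∨ i = finRotate N j := by
  rcases (hP.simple j).2 (P i) h with h | h
  · exact .inl (hP.injective h)
  · exact .inr (hP.injective h)

/-- Here the lattice matters: `IsJordan.disjoint` compares only interiors of sides, and it is the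
absence of further lattice points on a side that keeps the listed points out of these interiors. -/
lemma IsJordan.vertex_not_mem_openSegment (hP : IsJordan P) (i j : Fin N) :
    toReal P i ∉ openSegment ℝ (toReal P j) (toReal P (finRotate N j)) := by
  intro h
  rcases hP.vertex_mem (openSegment_subset_segment _ _ _ h) with rfl | rfl
  · exact hP.toReal_ne _ (left_mem_openSegment_iff.1 h)
  · exact hP.toReal_ne _ (right_mem_openSegment_iff.1 h)

lemma IsJordan.not_mem_segment (hP : IsJordan P) {i j : Fin N} (hij : i ≠ j) {z : ℝ × ℝ}
    (hz : z ∈ openSegment ℝ (toReal P i) (toReal P (finRotate N i))) :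
    z ∉ segment ℝ (toReal P j) (toReal P (finRotate N j)) := by
  intro h
  rw [← insert_endpoints_openSegment] at h
  rcases h with rfl | rfl | h
  · exact hP.vertex_not_mem_openSegment _ _ hz
  · exact hP.vertex_not_mem_openSegment _ _ hz
  · exact Set.disjoint_left.1 (hP.disjoint i j hij) hz h

lemma cross_dir_of_mem_segment {i : Fin N} {z : ℝ × ℝ}
    (hz : z ∈ segment ℝ (toReal P i) (toReal P (finRotate N i))) :
    cross (dir P i) z = cross (dir P i) (toReal P i) := by
  obtain ⟨a, b, -, -, hab, rfl⟩ := hz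
  obtain rfl : a = 1 - b := by linarith
  simp only [cross, dir, Prod.fst_sub, Prod.snd_sub, Prod.fst_add, Prod.snd_add, Prod.smul_fst,
    Prod.smul_snd, smul_eq_mul]
  ring

/-! ### Points near the interior of one side -/

/-- Points close to a side and strictly on one side of it lie in the same component of the
complement of the boundary. -/
lemma IsJordan.enclosed_iff_of_near (hP : IsJordan P) (i : Fin N) {z z' n n' : ℝ × ℝ}
    (hz : z ∈ openSegment ℝ (toReal P i) (toReal P (finRotate N i)))
    (hz' : z' ∈ openSegment ℝ (toReal P i) (toReal P (finRotate N i)))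
    (hn : 0 < cross (dir P i) n * cross (dir P i) n') :
    ∃ δ > (0 : ℝ), ∀ ε ∈ Set.Ioo 0 δ, ∀ ε' ∈ Set.Ioo 0 δ,
      (z + ε • n ∈ enclosed P ↔ z' + ε' • n' ∈ enclosed P) := by
  set O : Set (ℝ × ℝ) :=
    ⋃ j : {j : Fin N // j ≠ i}, segment ℝ (toReal P j) (toReal P (finRotate N j)) with hO
  have hOc : IsClosed O := isClosed_iUnion_of_finite fun i => isClosed_segment _ _
  have hK : IsCompact (segment ℝ z z') := by
    rw [← convexHull_pair]
    exact ((Set.finite_singleton z').insert z).isCompact_convexHull ℝ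
  have hKi : segment ℝ z z' ⊆ openSegment ℝ (toReal P i) (toReal P (finRotate N i)) :=
    (convex_openSegment _ _).segment_subset hz hz'
  have hKO : segment ℝ z z' ⊆ Oᶜ := by
    intro w hw hwO
    obtain ⟨⟨j, hj⟩, hwj⟩ := Set.mem_iUnion.1 hwO
    exact hP.not_mem_segment hj.symm (hKi hw) hwj
  -- The compact segment from `z` to `z'` has distance at least some `r > 0` from all other sides.
  -- Displacements shorter than `r` can therefore meet only side `i`, and the common sign of the
  -- cross products keeps them off its line.
  obtain ⟨r, hr, hrO⟩ := hK.exists_thickening_subset_open hOc.isOpen_compl hKO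
  set M := ‖n‖ + ‖n'‖ + 1 with hM
  have hMpos : 0 < M := by positivity
  refine ⟨r / M, by positivity, fun ε hε ε' hε' => ?_⟩
  have hT : ∀ w ∈ segment ℝ (z + ε • n) (z' + ε' • n'), w ∉ (toReal P).boundary ℝ := by
    rintro w ⟨a, b, ha, hb, hab, rfl⟩ hw
    obtain ⟨j, hj⟩ := mem_boundary.1 hw
    have hsplit : a • (z + ε • n) + b • (z' + ε' • n') =
        (a • z + b • z') + ((a * ε) • n + (b * ε') • n') := by module
    have hk : a • z + b • z' ∈ segment ℝ z z' := ⟨a, b, ha, hb, hab, rfl⟩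
    rw [hsplit] at hj
    by_cases hji : j = i
    · subst hji
      have h1 := cross_dir_of_mem_segment hj
      have h2 := cross_dir_of_mem_segment (openSegment_subset_segment _ _ _ (hKi hk))
      rw [cross_add_right, h2, cross_add_right, cross_smul_right, cross_smul_right] at h1
      have h3 : a * ε * cross (dir P j) n + b * ε' * cross (dir P j) n' = 0 := by linarith
      have h4 : 0 < a * ε + b * ε' := by
        rcases ha.eq_or_lt with rfl | ha
        · obtain rfl : b = 1 := by linarith
          simpa using hε'.1
        · have := mul_pos ha hε.1
          have := mul_nonneg hb hε'.1.le
          linarith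
      have h5 : 0 ≤ a * ε := mul_nonneg ha hε.1.le
      have h6 : 0 ≤ b * ε' := mul_nonneg hb hε'.1.le
      rcases pos_and_pos_or_neg_and_neg_of_mul_pos hn with ⟨p, q⟩ | ⟨p, q⟩ <;>
      rcases h5.eq_or_lt with h5 | h5 <;> rcases h6.eq_or_lt with h6 | h6 <;>
      nlinarith
    · refine hrO (Metric.mem_thickening_iff.2 ⟨_, hk, ?_⟩) (Set.mem_iUnion.2 ⟨⟨j, hji⟩, hj⟩)
      rw [dist_eq_norm, add_sub_cancel_left]
      have e1 : ε * M < r := by rw [← lt_div_iff₀ hMpos]; exact hε.2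
      have e2 : ε' * M < r := by rw [← lt_div_iff₀ hMpos]; exact hε'.2
      calc ‖(a * ε) • n + (b * ε') • n'‖ ≤ ‖(a * ε) • n‖ + ‖(b * ε') • n'‖ := norm_add_le _ _
        _ = a * (ε * ‖n‖) + b * (ε' * ‖n'‖) := by
          rw [norm_smul, norm_smul, Real.norm_of_nonneg (mul_nonneg ha hε.1.le),
            Real.norm_of_nonneg (mul_nonneg hb hε'.1.le)]
          ring
        _ ≤ a * (ε * M) + b * (ε' * M) := by
          have := hε.1.le
          have := hε'.1.le
          gcongr <;> linarith [norm_nonneg n, norm_nonneg n']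
        _ < r := by
          rcases ha.eq_or_lt with rfl | ha
          · obtain rfl : b = 1 := by linarith
            simpa using e2
          · have := mul_lt_mul_of_pos_left e1 ha
            have := mul_le_mul_of_nonneg_left e2.le hb
            have : a * r + b * r = r := by rw [← add_mul, hab, one_mul]
            linarith
  have hc : IsPreconnected (segment ℝ (z + ε • n) (z' + ε' • n')) :=
    (convex_segment _ _).isPreconnected
  exact ⟨fun h => IsPreconnected.subset_enclosed hc hT (left_mem_segment _ _ _) h
      (right_mem_segment _ _ _),
    fun h => IsPreconnected.subset_enclosed hc hT (right_mem_segment _ _ _) h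
      (left_mem_segment _ _ _)⟩

/-! ### Sectors between two rays, in polar coordinates -/

/-- The number `w` is the complex quotient `b / a`; its argument is moved from `(-π, π]` to `(0,
2π)`, and `hab` excludes the argument 0. -/
lemma exists_polar {a b : ℝ × ℝ} (ha : a ≠ 0) (hb : b ≠ 0) (hab : ∀ μ : ℝ, 0 < μ → b ≠ μ • a) :
    ∃ l > (0 : ℝ), ∃ Φ ∈ Set.Ioo 0 (2 * Real.pi),
      b = l • (Real.cos Φ • a + Real.sin Φ • turnLeft a) := by
  obtain ⟨a1, a2⟩ := a
  obtain ⟨b1, b2⟩ := b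
  have hD : 0 < a1 ^ 2 + a2 ^ 2 := by
    rcases eq_or_ne a1 0 with rfl | h
    · have : a2 ≠ 0 := fun h => ha (by simp [h])
      positivity
    · positivity
  set D := a1 ^ 2 + a2 ^ 2 with hDdef
  set w : ℂ := ⟨(a1 * b1 + a2 * b2) / D, (a1 * b2 - a2 * b1) / D⟩ with hw
  have hrep : ((b1, b2) : ℝ × ℝ) = w.re • (a1, a2) + w.im • turnLeft (a1, a2) := by
    simp only [hw, turnLeft, Prod.smul_mk, smul_eq_mul, Prod.mk_add_mk, Prod.mk.injEq]
    constructor <;> field_simp <;> rw [hDdef] <;> ring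
  have hw0 : w ≠ 0 := by
    intro h
    rw [h] at hrep
    exact hb (by simpa using hrep)
  have hre : w.re = ‖w‖ * Real.cos w.arg := (Complex.norm_mul_cos_arg w).symm
  have him : w.im = ‖w‖ * Real.sin w.arg := (Complex.norm_mul_sin_arg w).symm
  have hn : 0 < ‖w‖ := norm_pos_iff.2 hw0
  rw [hre, him] at hrep
  refine ⟨‖w‖, hn, ?_⟩
  rcases lt_trichotomy w.arg 0 with h | h | h
  · refine ⟨w.arg + 2 * Real.pi, ⟨?_, by linarith⟩, ?_⟩
    · linarith [Complex.neg_pi_lt_arg w, Real.pi_pos]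
    · rw [Real.cos_add_two_pi, Real.sin_add_two_pi, hrep, smul_add, smul_smul, smul_smul]
  · rw [h] at hrep
    exact absurd (by simpa using hrep) (hab _ hn)
  · refine ⟨w.arg, ⟨h, ?_⟩, ?_⟩
    · linarith [Complex.arg_le_pi w, Real.pi_pos]
    · rw [hrep, smul_add, smul_smul, smul_smul]

/-- The point with polar coordinates `(s, φ)`, relative to the frame `a`, `turnLeft a`. -/
noncomputable def polarPoint (a : ℝ × ℝ) (p : ℝ × ℝ) : ℝ × ℝ :=
  p.1 • (Real.cos p.2 • a + Real.sin p.2 • turnLeft a)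

lemma continuous_polarPoint (a : ℝ × ℝ) : Continuous (polarPoint a) := by
  unfold polarPoint; fun_prop

lemma eq_of_combo_eq {a : ℝ × ℝ} (ha : a ≠ 0) {p q p' q' : ℝ}
    (h : p • a + q • turnLeft a = p' • a + q' • turnLeft a) : p = p' ∧ q = q' := by
  obtain ⟨a1, a2⟩ := a
  have hD : 0 < a1 ^ 2 + a2 ^ 2 := by
    rcases eq_or_ne a1 0 with rfl | h
    · have : a2 ≠ 0 := fun h => ha (by simp [h])
      positivity
    · positivity
  simp only [turnLeft, Prod.smul_mk, smul_eq_mul, Prod.mk_add_mk, Prod.mk.injEq] at h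
  obtain ⟨h1, h2⟩ := h
  constructor
  · have : (p - p') * (a1 ^ 2 + a2 ^ 2) = 0 := by linear_combination a1 * h1 + a2 * h2
    rcases mul_eq_zero.1 this with h | h <;> linarith
  · have : (q - q') * (a1 ^ 2 + a2 ^ 2) = 0 := by linear_combination a1 * h2 - a2 * h1
    rcases mul_eq_zero.1 this with h | h <;> linarith

/-- Equality would make the sine of `φ - Φ` zero and its cosine nonnegative, so `φ - Φ` would be a
multiple of `2π`, and `h0` leaves only 0. -/
lemma polarPoint_ne {a : ℝ × ℝ} (ha : a ≠ 0) {l s t Φ φ : ℝ} (hl : 0 < l) (hs : 0 < s)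
    (ht : 0 ≤ t) (h0 : φ - Φ ∈ Set.Ioo (-(2 * Real.pi)) (2 * Real.pi)) (hne : φ ≠ Φ) :
    polarPoint a (s, φ) ≠ t • (l • (Real.cos Φ • a + Real.sin Φ • turnLeft a)) := by
  intro h
  simp only [polarPoint, smul_add, smul_smul] at h
  obtain ⟨h1, h2⟩ := eq_of_combo_eq ha h
  have hsin : s * Real.sin (φ - Φ) = 0 := by
    rw [Real.sin_sub]; linear_combination Real.cos Φ * h2 - Real.sin Φ * h1
  have hcos : s * Real.cos (φ - Φ) = t * l := by
    rw [Real.cos_sub]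
    linear_combination Real.cos Φ * h1 + Real.sin Φ * h2 + t * l * Real.sin_sq_add_cos_sq Φ
  have hsin' : Real.sin (φ - Φ) = 0 := (mul_eq_zero.1 hsin).resolve_left hs.ne'
  have hcos' : 0 ≤ Real.cos (φ - Φ) := by
    by_contra hc
    nlinarith [mul_nonneg ht hl.le]
  have hcos1 : Real.cos (φ - Φ) = 1 := by
    rcases Real.sin_eq_zero_iff_cos_eq.1 hsin' with h | h
    · exact h
    · linarith
  have := (Real.cos_eq_one_iff_of_lt_of_lt h0.1 h0.2).1 hcos1
  exact hne (by linarith)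

/-- The norm of `ℝ × ℝ` is the maximum norm, which rotations do not preserve; hence the factor 2. -/
lemma norm_polarPoint_le (a : ℝ × ℝ) {s φ : ℝ} (hs : 0 ≤ s) :
    ‖polarPoint a (s, φ)‖ ≤ s * (2 * ‖a‖) := by
  have hJ : ‖turnLeft a‖ = ‖a‖ := by
    simp [turnLeft, Prod.norm_def, max_comm]
  rw [polarPoint, norm_smul, Real.norm_of_nonneg hs]
  gcongr
  calc _ ≤ ‖Real.cos φ • a‖ + ‖Real.sin φ • turnLeft a‖ := norm_add_le _ _
    _ ≤ 1 * ‖a‖ + 1 * ‖a‖ := by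
      rw [norm_smul, norm_smul, hJ]
      gcongr
      · exact Real.abs_cos_le_one φ
      · exact Real.abs_sin_le_one φ
    _ = 2 * ‖a‖ := by ring

/-- For `t > 0`, the point with frame coordinates `(t, t * x)` has radius `t * √(1 + x ^ 2)` and
angle `arctan x`; used with `x = ε / t`. -/
lemma mul_sqrt_mul_cos_arctan (t x : ℝ) :
    t * √(1 + x ^ 2) * Real.cos (Real.arctan x) = t := by
  have : √(1 + x ^ 2) ≠ 0 := by positivity
  rw [Real.cos_arctan]; field_simp

lemma mul_sqrt_mul_sin_arctan (t x : ℝ) :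
    t * √(1 + x ^ 2) * Real.sin (Real.arctan x) = t * x := by
  have : √(1 + x ^ 2) ≠ 0 := by positivity
  rw [Real.sin_arctan]; field_simp

/-- Two rays from the origin bound a connected open sector on the left of the first ray and on the
right of the second. -/
lemma exists_sector {a b : ℝ × ℝ} (ha : a ≠ 0) (hb : b ≠ 0)
    (hab : ∀ μ : ℝ, 0 < μ → b ≠ μ • a) {r : ℝ} (hr : 0 < r) :
    ∃ T : Set (ℝ × ℝ), IsPreconnected T ∧ (∀ w ∈ T, ‖w‖ < r) ∧
      (∀ w ∈ T, ∀ t : ℝ, 0 ≤ t → w ≠ t • a ∧ w ≠ t • b) ∧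
      ∃ t ∈ Set.Ioo (0 : ℝ) 1, (∀ᶠ ε in 𝓝[>] (0 : ℝ), t • a + ε • turnLeft a ∈ T) ∧
        ∀ᶠ ε in 𝓝[>] (0 : ℝ), t • b + ε • -turnLeft b ∈ T := by
  obtain ⟨l, hl, Φ, hΦ, hbΦ⟩ := exists_polar ha hb hab
  have hna : 0 < ‖a‖ := norm_pos_iff.2 ha
  set ρ := r / (2 * ‖a‖) with hρ
  have hρpos : 0 < ρ := by positivity
  refine ⟨polarPoint a '' (Set.Ioo 0 ρ ×ˢ Set.Ioo 0 Φ),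
    (isPreconnected_Ioo.prod isPreconnected_Ioo).image _ (continuous_polarPoint a).continuousOn,
    ?_, ?_, ?_⟩
  · rintro _ ⟨⟨s, φ⟩, ⟨hs, -⟩, rfl⟩
    refine (norm_polarPoint_le a hs.1.le).trans_lt ?_
    rw [← lt_div_iff₀ (by positivity)]
    exact hs.2
  · rintro _ ⟨⟨s, φ⟩, ⟨hs, hφ⟩, rfl⟩ t ht
    simp only [Set.mem_Ioo] at hs hφ hΦ
    constructor
    · have := polarPoint_ne ha (l := 1) (Φ := 0) (φ := φ) one_pos hs.1 ht
        ⟨by linarith, by linarith⟩ hφ.1.ne'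
      simpa using this
    · rw [hbΦ]
      exact polarPoint_ne ha hl hs.1 ht ⟨by linarith, by linarith⟩ hφ.2.ne
  -- The polar radii of `t • a` and `t • b` are `t` and `l * t`; both must stay below `ρ`, and `t <
  -- 1` places the base points inside the sides.
  · set t := min (1 / 2) (min (ρ / 2) (ρ / (2 * l))) with ht
    have htpos : 0 < t := by positivity
    have ht1 : t < 1 := (min_le_left _ _).trans_lt (by norm_num)
    have htρ : t < ρ := ((min_le_right _ _).trans (min_le_left _ _)).trans_lt (by linarith)
    have htl : l * t < ρ := by
      have h : t ≤ ρ / (2 * l) := (min_le_right _ _).trans (min_le_right _ _)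
      rw [le_div_iff₀ (by positivity)] at h
      nlinarith
    have key : ∀ c : ℝ, c < ρ → ∀ᶠ ε in 𝓝[>] (0 : ℝ),
        c * √(1 + (ε / t) ^ 2) < ρ ∧ Real.arctan (ε / t) < Φ := by
      intro c hc
      have h1 : Continuous fun ε : ℝ => c * √(1 + (ε / t) ^ 2) := by fun_prop
      have h2 : Continuous fun ε : ℝ => Real.arctan (ε / t) :=
        Real.continuous_arctan.comp (by fun_prop)
      exact nhdsWithin_le_nhds (((h1.tendsto 0).eventually_lt_const (by simpa using hc)).and
        ((h2.tendsto 0).eventually_lt_const (by simpa using hΦ.1)))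
    refine ⟨t, ⟨htpos, ht1⟩, ?_, ?_⟩
    · filter_upwards [key t htρ, self_mem_nhdsWithin] with ε hε hε0
      have hε0 : 0 < ε := hε0
      refine ⟨(t * √(1 + (ε / t) ^ 2), Real.arctan (ε / t)),
        ⟨⟨by positivity, hε.1⟩, Real.arctan_pos.2 (by positivity), hε.2⟩, ?_⟩
      simp only [polarPoint, smul_add, smul_smul]
      rw [mul_sqrt_mul_cos_arctan, mul_sqrt_mul_sin_arctan, mul_div_cancel₀ _ htpos.ne']
    · filter_upwards [key (l * t) htl, self_mem_nhdsWithin] with ε hε hε0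
      have hε0 : 0 < ε := hε0
      have hat : 0 < Real.arctan (ε / t) := Real.arctan_pos.2 (by positivity)
      refine ⟨(l * t * √(1 + (ε / t) ^ 2), Φ - Real.arctan (ε / t)),
        ⟨⟨by positivity, hε.1⟩, sub_pos.2 hε.2, by simpa using hat⟩, ?_⟩
      have e1 := mul_sqrt_mul_cos_arctan (l * t) (ε / t)
      have e2 := mul_sqrt_mul_sin_arctan (l * t) (ε / t)
      have e3 : l * t * (ε / t) = l * ε := by field_simp
      rw [e3] at e2
      rw [hbΦ]
      simp only [polarPoint, Real.cos_sub, Real.sin_sub]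
      generalize √(1 + (ε / t) ^ 2) = Q at *
      generalize Real.arctan (ε / t) = α at *
      simp only [turnLeft]
      ext
      · simp only [Prod.fst_add, Prod.smul_fst, smul_eq_mul, Prod.smul_snd, Prod.fst_neg,
          Prod.snd_add]
        linear_combination (Real.cos Φ * a.1 - Real.sin Φ * a.2) * e1 +
          (Real.sin Φ * a.1 + Real.cos Φ * a.2) * e2
      · simp only [Prod.fst_add, Prod.smul_fst, smul_eq_mul, Prod.smul_snd, Prod.snd_neg,
          Prod.snd_add]
        linear_combination (Real.cos Φ * a.2 + Real.sin Φ * a.1) * e1 +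
          (Real.sin Φ * a.2 - Real.cos Φ * a.1) * e2

/-! ### Carrying the right side of the path around its corners -/

/-- Since near points on one side of a side share a component, one enclosed point close enough
decides for all base points and all directions to that side. -/
lemma IsJordan.eventually_enclosed (hP : IsJordan P) (i : Fin N) {z z' n n' : ℝ × ℝ}
    (hz : z ∈ openSegment ℝ (toReal P i) (toReal P (finRotate N i)))
    (hz' : z' ∈ openSegment ℝ (toReal P i) (toReal P (finRotate N i)))
    (hn : 0 < cross (dir P i) n * cross (dir P i) n')
    (h : ∃ᶠ ε in 𝓝[>] (0 : ℝ), z + ε • n ∈ enclosed P) :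
    ∀ᶠ ε in 𝓝[>] (0 : ℝ), z' + ε • n' ∈ enclosed P := by
  obtain ⟨δ, hδ, H⟩ := hP.enclosed_iff_of_near i hz hz' hn
  obtain ⟨ε, hε, hεδ⟩ := (h.and_eventually (Ioo_mem_nhdsGT hδ)).exists
  filter_upwards [Ioo_mem_nhdsGT hδ] with ε' hε'
  exact (H ε hεδ ε' hε').1 hε

/-- The points immediately to the right of the side with index `i` are enclosed. -/
def RightEnclosed (P : Polygon (ℤ × ℤ) N) (i : Fin N) : Prop :=
  ∀ z ∈ openSegment ℝ (toReal P i) (toReal P (finRotate N i)), ∀ n, cross (dir P i) n < 0 →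
    ∀ᶠ ε in 𝓝[>] (0 : ℝ), z + ε • n ∈ enclosed P

lemma IsJordan.rightEnclosed_of_frequently (hP : IsJordan P) {i : Fin N} {z n : ℝ × ℝ}
    (hz : z ∈ openSegment ℝ (toReal P i) (toReal P (finRotate N i)))
    (hn : cross (dir P i) n < 0) (h : ∃ᶠ ε in 𝓝[>] (0 : ℝ), z + ε • n ∈ enclosed P) :
    RightEnclosed P i := fun _ hz' _ hn' =>
  hP.eventually_enclosed i hz hz' (mul_pos_of_neg_of_neg hn hn') h

lemma cross_turnLeft_self_pos {v : ℝ × ℝ} (hv : v ≠ 0) : 0 < cross v (turnLeft v) := by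
  obtain ⟨a, b⟩ := v
  simp only [cross, turnLeft]
  rcases eq_or_ne a 0 with rfl | h
  · have : b ≠ 0 := fun h => hv (by simp [h])
    have : 0 < b ^ 2 := by positivity
    linarith
  · have : 0 < a ^ 2 := by positivity
    nlinarith [sq_nonneg b]

/-- At the common corner `v`, the reversed side `-dir P i` and the next side `dir P j` bound a
sector lying to the right of the path along both. A small sector avoids every other side, so it is
enclosed as a whole once it contains one enclosed point. -/
lemma IsJordan.rightEnclosed_finRotate (hP : IsJordan P) {i : Fin N} (h : RightEnclosed P i) :
    RightEnclosed P (finRotate N i) := by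
  set j := finRotate N i with hj
  set v := toReal P j with hv
  set O : Set (ℝ × ℝ) := ⋃ k : {k : Fin N // k ≠ i ∧ k ≠ j},
    segment ℝ (toReal P k) (toReal P (finRotate N k)) with hO
  have hOc : IsClosed O := isClosed_iUnion_of_finite fun i => isClosed_segment _ _
  have hvO : v ∈ Oᶜ := by
    intro h
    obtain ⟨⟨k, hki, hkj⟩, hk⟩ := Set.mem_iUnion.1 h
    rcases hP.vertex_mem hk with h | h
    · exact hkj h.symm
    · exact hki ((finRotate N).injective (hj ▸ h)).symm
  obtain ⟨r, hr, hrO⟩ := Metric.isOpen_iff.1 hOc.isOpen_compl v hvO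
  have hij : i ≠ j := fun h => (hP.simple i).1 (by rw [← hj, ← h])
  have ha : -dir P i ≠ 0 := neg_ne_zero.2 (hP.dir_ne_zero i)
  have hb : dir P j ≠ 0 := hP.dir_ne_zero j
  have hsi : ∀ t ∈ Set.Ioo (0 : ℝ) 1, v + t • -dir P i ∈
      openSegment ℝ (toReal P i) (toReal P (finRotate N i)) := fun t ht =>
    ⟨t, 1 - t, ht.1, by linarith [ht.2], by ring, by simp only [dir, ← hj, ← hv]; module⟩
  have hsj : ∀ t ∈ Set.Ioo (0 : ℝ) 1, v + t • dir P j ∈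
      openSegment ℝ (toReal P j) (toReal P (finRotate N j)) := fun t ht =>
    ⟨1 - t, t, by linarith [ht.2], ht.1, by ring, by simp only [dir, ← hv]; module⟩
  have hab : ∀ μ : ℝ, 0 < μ → dir P j ≠ μ • -dir P i := by
    intro μ hμ he
    -- If the path turned straight back, the point at fraction `μ / (μ + 1)` of the reversed side
    -- `i` would be the point at fraction `1 / (μ + 1)` of side `j`, interior to both.
    have h1 : (1 / (μ + 1)) ∈ Set.Ioo (0 : ℝ) 1 :=
      ⟨by positivity, by rw [div_lt_one (by positivity)]; linarith⟩
    have h2 : μ * (1 / (μ + 1)) ∈ Set.Ioo (0 : ℝ) 1 :=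
      ⟨by positivity, by rw [mul_one_div, div_lt_one (by positivity)]; linarith⟩
    refine Set.disjoint_left.1 (hP.disjoint i j hij) (hsi _ h2) ?_
    have := hsj _ h1
    rwa [he, smul_smul, mul_comm _ μ] at this
  obtain ⟨T, hTc, hTr, hTab, t, ht, hta, htb⟩ := exists_sector ha hb hab hr
  have hT' : IsPreconnected ((fun w => v + w) '' T) := hTc.image _ (by fun_prop)
  have hTB : ∀ z ∈ (fun w => v + w) '' T, z ∉ (toReal P).boundary ℝ := by
    rintro _ ⟨w, hw, rfl⟩ hwB
    obtain ⟨k, hk⟩ := mem_boundary.1 hwB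
    by_cases hki : k = i
    · subst hki
      obtain ⟨c, d, hc, hd, hcd, he⟩ := hk
      refine (hTab w hw c hc).1 ?_
      rw [← hj, ← hv] at he
      obtain rfl : d = 1 - c := by linarith
      have : w = c • toReal P k + (1 - c) • v - v := by rw [he]; simp
      rw [this, dir, ← hj, ← hv]; module
    · by_cases hkj : k = j
      · rw [hkj] at hk
        obtain ⟨c, d, hc, hd, hcd, he⟩ := hk
        refine (hTab w hw d hd).2 ?_
        obtain rfl : c = 1 - d := by linarith
        have : w = (1 - d) • v + d • toReal P (finRotate N j) - v := by rw [hv, he]; simp [hv]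
        rw [this, dir, ← hv]; module
      · refine hrO ?_ (Set.mem_iUnion.2 ⟨⟨k, hki, hkj⟩, hk⟩)
        simpa using hTr w hw
  have hn1 : cross (dir P i) (turnLeft (-dir P i)) < 0 := by
    have := cross_turnLeft_self_pos ha
    simp only [cross, Prod.fst_neg, Prod.snd_neg] at this ⊢
    linarith
  have hn2 : cross (dir P j) (-turnLeft (dir P j)) < 0 := by
    have := cross_turnLeft_self_pos hb
    simp only [cross, Prod.fst_neg, Prod.snd_neg] at this ⊢
    linarith
  obtain ⟨ε, h1, h2⟩ := ((h _ (hsi t ht) _ hn1).and hta).exists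
  rw [add_assoc] at h1
  have hTE := IsPreconnected.subset_enclosed hT' hTB ⟨_, h2, rfl⟩ h1
  refine hP.rightEnclosed_of_frequently (hsj t ht) hn2 (htb.mono fun ε hε => ?_).frequently
  rw [add_assoc]
  exact hTE ⟨_, hε, rfl⟩

lemma IsJordan.rightEnclosed_all (hP : IsJordan P) {i : Fin N} (h : RightEnclosed P i)
    (j : Fin N) : RightEnclosed P j := by
  have : NeZero N := ⟨by rintro rfl; exact i.elim0⟩
  have hk : ∀ k : ℕ, RightEnclosed P ((finRotate N)^[k] i) := by
    intro k
    induction k with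
    | zero => exact h
    | succ k ih => rw [Function.iterate_succ_apply']; exact hP.rightEnclosed_finRotate ih
  have := hk (j - i).1
  rwa [← finCycle_eq_finRotate_iterate, finCycle_apply, add_sub_cancel] at this

/-! ### Length of a subset of the line from its jumps -/

/-- A set of reals that changes only at finitely many points, with jump `s i` at `y i`. -/
structure IsStepSet {ι : Type*} (E : Set ℝ) (I : Finset ι) (y s : ι → ℝ) : Prop where
  injOn : Set.InjOn y I
  const : ∀ a b, a ≤ b → (∀ i ∈ I, y i ∉ Set.Icc a b) → (a ∈ E ↔ b ∈ E)
  jump : ∀ i ∈ I,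
    (s i = 1 ∧ ∀ᶠ ε in 𝓝[>] (0 : ℝ), y i + ε ∈ E ∧ y i - ε ∉ E) ∨
    (s i = -1 ∧ ∀ᶠ ε in 𝓝[>] (0 : ℝ), y i + ε ∉ E ∧ y i - ε ∈ E)
  bounded : ∃ K, ∀ t, t < K → t ∉ E

-- Induction on the number of jumps below `t`. Membership is constant from just above the highest
-- such jump up to `t`, and the induction hypothesis applies just below it.
open Classical in
lemma IsStepSet.indicator_eq {ι : Type*} {E : Set ℝ} {I : Finset ι} {y s : ι → ℝ}
    (h : IsStepSet E I y s) (t : ℝ) (ht : ∀ i ∈ I, y i ≠ t) :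
    E.indicator (fun _ => (1 : ℝ)) t = ∑ i ∈ I with y i < t, s i := by
  induction hn : (I.filter (y · < t)).card generalizing t with
  | zero =>
    rw [Finset.card_eq_zero] at hn
    rw [hn, Finset.sum_empty]
    obtain ⟨K, hK⟩ := h.bounded
    refine Set.indicator_of_notMem (fun htE => ?_) _
    refine hK (min t (K - 1)) ((min_le_right _ _).trans_lt (by linarith))
      ((h.const (min t (K - 1)) t (min_le_left _ _) fun i hi hy => ?_).2 htE)
    have : i ∈ I.filter (y · < t) :=
      Finset.mem_filter.2 ⟨hi, lt_of_le_of_ne hy.2 (ht i hi)⟩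
    simp [hn] at this
  | succ n ih =>
    obtain ⟨j, hj, hmax⟩ := (I.filter (y · < t)).exists_max_image y
      (Finset.card_pos.1 (by omega))
    obtain ⟨hjI, hjt⟩ := Finset.mem_filter.1 hj
    have hgap : ∀ᶠ ε in 𝓝[>] (0 : ℝ), ∀ i ∈ I.filter (y · < t), i ≠ j → y i < y j - ε := by
      rw [Filter.eventually_all_finset]
      intro i hi
      have hlt : i ≠ j → y i < y j := fun hij => lt_of_le_of_ne (hmax i hi)
        fun he => hij (h.injOn (Finset.mem_filter.1 hi).1 hjI he)
      by_cases hij : i = j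
      · simp [hij]
      · filter_upwards [Ioo_mem_nhdsGT (sub_pos.2 (hlt hij))] with ε hε _
        linarith [hε.2]
    have hcross : ∀ᶠ ε in 𝓝[>] (0 : ℝ), y j + ε < t ∧ 0 < ε := by
      filter_upwards [Ioo_mem_nhdsGT (sub_pos.2 hjt)] with ε hε
      exact ⟨by linarith [hε.2], hε.1⟩
    have hfilt : ∀ ε, 0 < ε → (∀ i ∈ I.filter (y · < t), i ≠ j → y i < y j - ε) →
        I.filter (y · < y j - ε) = (I.filter (y · < t)).erase j := by
      intro ε hε hg
      ext i
      simp only [Finset.mem_filter, Finset.mem_erase]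
      constructor
      · rintro ⟨hi, hy⟩
        exact ⟨fun e => by subst e; linarith, hi, by linarith⟩
      · rintro ⟨hij, hi, hy⟩
        exact ⟨hi, hg i (Finset.mem_filter.2 ⟨hi, hy⟩) hij⟩
    have hbelow : ∀ ε, 0 < ε → (∀ i ∈ I.filter (y · < t), i ≠ j → y i < y j - ε) →
        E.indicator (fun _ => (1 : ℝ)) (y j - ε) + s j = ∑ i ∈ I with y i < t, s i := by
      intro ε hε hg
      rw [ih (y j - ε), hfilt ε hε hg, Finset.sum_erase_add _ _ hj]
      · intro i hi he
        by_cases hij : i = j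
        · subst hij; linarith
        · have := hmax i (Finset.mem_filter.2 ⟨hi, by linarith⟩)
          have := hg i (Finset.mem_filter.2 ⟨hi, by linarith⟩) hij
          linarith
      · rw [hfilt ε hε hg, Finset.card_erase_of_mem hj, hn]; rfl
    have habove : ∀ ε, y j + ε < t → 0 < ε → (y j + ε ∈ E ↔ t ∈ E) := by
      intro ε h1 h2
      refine h.const _ _ h1.le fun i hi hy => ?_
      have := hmax i (Finset.mem_filter.2 ⟨hi, lt_of_le_of_ne hy.2 (ht i hi)⟩)
      linarith [hy.1]
    rcases h.jump j hjI with ⟨hs, hev⟩ | ⟨hs, hev⟩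
    · obtain ⟨ε, ⟨hE1, hE2⟩, hg, h1, h2⟩ := (hev.and (hgap.and hcross)).exists
      rw [← hbelow ε h2 hg, hs, Set.indicator_of_mem ((habove ε h1 h2).1 hE1),
        Set.indicator_of_notMem hE2, zero_add]
    · obtain ⟨ε, ⟨hE1, hE2⟩, hg, h1, h2⟩ := (hev.and (hgap.and hcross)).exists
      rw [← hbelow ε h2 hg, hs, Set.indicator_of_notMem (mt (habove ε h1 h2).2 hE1),
        Set.indicator_of_mem hE2, add_neg_cancel]

/-- Jump `i` contributes `s i` on all of `(y i, M]`; the jump points themselves form a null set. -/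
lemma IsStepSet.volume_eq {ι : Type*} {E : Set ℝ} {I : Finset ι} {y s : ι → ℝ}
    (h : IsStepSet E I y s) (hE : MeasurableSet E) {M : ℝ} (hM : E ⊆ Set.Icc (-M) M)
    (hy : ∀ i ∈ I, y i ∈ Set.Icc (-M) M) :
    volume.real E = ∑ i ∈ I, s i * (M - y i) := by
  classical
  have h1 : volume.real E =
      ∫ t in Set.Icc (-M) M, E.indicator (fun _ => (1 : ℝ)) t := by
    rw [setIntegral_indicator hE, Set.inter_eq_right.2 hM]
    simp
  have h2 : ∫ t in Set.Icc (-M) M, E.indicator (fun _ => (1 : ℝ)) t =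
      ∫ t in Set.Icc (-M) M, ∑ i ∈ I, (Set.Ioi (y i)).indicator (fun _ => s i) t := by
    refine integral_congr_ae (ae_restrict_of_ae ?_)
    have hfin : (y '' (I : Set ι)).Finite := I.finite_toSet.image y
    filter_upwards [hfin.countable.ae_notMem volume] with t ht
    rw [h.indicator_eq t (fun i hi he => ht ⟨i, hi, he⟩), Finset.sum_filter]
    refine Finset.sum_congr rfl fun i _ => ?_
    simp [Set.indicator_apply]
  rw [h1, h2, integral_finsetSum]
  · refine Finset.sum_congr rfl fun i hi => ?_
    have he : Set.Icc (-M) M ∩ Set.Ioi (y i) = Set.Ioc (y i) M := by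
      ext t
      simp only [Set.mem_inter_iff, Set.mem_Icc, Set.mem_Ioi, Set.mem_Ioc]
      exact ⟨fun h => ⟨h.2, h.1.2⟩, fun h => ⟨⟨(hy i hi).1.trans h.1.le, h.2⟩, h.1⟩⟩
    rw [setIntegral_indicator measurableSet_Ioi, he, setIntegral_const, smul_eq_mul,
      Real.volume_real_Ioc_of_le (hy i hi).2, mul_comm]
  · intro i _
    exact (integrable_const _).indicator measurableSet_Ioi

/-! ### Vertical slices of the region -/

/-- A half-plane beyond a bound of the boundary is connected and unbounded, so it contains no
enclosed point. Four coordinate half-planes suffice for the maximum norm. -/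
lemma exists_norm_bound (P : Polygon (ℤ × ℤ) N) :
    ∃ K, 0 ≤ K ∧ (∀ z ∈ (toReal P).boundary ℝ, ‖z‖ ≤ K) ∧ ∀ z ∈ enclosed P, ‖z‖ ≤ K := by
  have hb : Bornology.IsBounded ((toReal P).boundary ℝ) := by
    simp only [Polygon.boundary, edgeSet_eq]
    refine Bornology.isBounded_iUnion.2 fun i => ?_
    rw [← convexHull_pair]
    exact isBounded_convexHull.2 ((Set.finite_singleton _).insert _).isBounded
  obtain ⟨K', hK'⟩ := hb.exists_norm_le
  set K := max K' 0
  have hK : ∀ z ∈ (toReal P).boundary ℝ, ‖z‖ ≤ K := fun z hz => (hK' z hz).trans (le_max_left _ _)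
  have hfar : ∀ (f : (ℝ × ℝ) →ₗ[ℝ] ℝ) (u : ℝ × ℝ), f u = 1 → ‖u‖ = 1 → (∀ z, f z ≤ ‖z‖) →
      ∀ z ∈ enclosed P, f z ≤ K := by
    intro f u hu hu1 hf z hz
    by_contra! hlt
    refine not_mem_enclosed_of_unbounded (T := {w | K < f w}) ?_ ?_ ?_ hlt hz
    · exact (convex_halfSpace_gt f.isLinear K).isPreconnected
    · intro w hw hwB
      exact absurd ((hf w).trans (hK w hwB)) (not_le.2 hw)
    · intro hT
      obtain ⟨C, hC⟩ := hT.exists_norm_le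
      have h1 : K < f ((max K C + 1) • u) := by
        rw [map_smul, hu, smul_eq_mul, mul_one]
        linarith [le_max_left K C]
      have h2 := hC _ h1
      rw [norm_smul, hu1, mul_one] at h2
      linarith [le_max_right K C, Real.le_norm_self (max K C + 1)]
  refine ⟨K, le_max_right _ _, hK, fun z hz => ?_⟩
  rw [Prod.norm_def, Real.norm_eq_abs, Real.norm_eq_abs]
  have hle1 : ∀ z : ℝ × ℝ, |z.1| ≤ ‖z‖ := fun z => norm_fst_le z
  have hle2 : ∀ z : ℝ × ℝ, |z.2| ≤ ‖z‖ := fun z => norm_snd_le z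
  refine max_le (abs_le'.2 ⟨?_, ?_⟩) (abs_le'.2 ⟨?_, ?_⟩)
  · exact hfar (LinearMap.fst ℝ ℝ ℝ) (1, 0) (by simp) (by simp [Prod.norm_def])
      (fun z => (le_abs_self _).trans (hle1 z)) z hz
  · exact hfar (-LinearMap.fst ℝ ℝ ℝ) (-1, 0) (by simp) (by simp [Prod.norm_def])
      (fun z => (neg_le_abs _).trans (hle1 z)) z hz
  · exact hfar (LinearMap.snd ℝ ℝ ℝ) (0, 1) (by simp) (by simp [Prod.norm_def])
      (fun z => (le_abs_self _).trans (hle2 z)) z hz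
  · exact hfar (-LinearMap.snd ℝ ℝ ℝ) (0, -1) (by simp) (by simp [Prod.norm_def])
      (fun z => (neg_le_abs _).trans (hle2 z)) z hz

/-- The height at which the side with index `i` meets the vertical line with abscissa `x`. -/
noncomputable def height (P : Polygon (ℤ × ℤ) N) (x : ℝ) (i : Fin N) : ℝ :=
  (toReal P i).2 + (x - (toReal P i).1) / (dir P i).1 * (dir P i).2

open Classical in
/-- The sides crossed by the vertical line with abscissa `x`. -/
noncomputable def crossing (P : Polygon (ℤ × ℤ) N) (x : ℝ) : Finset (Fin N) :=
  Finset.univ.filter fun i => ((toReal P i).1 < x ∧ x < (toReal P (finRotate N i)).1) ∨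
    ((toReal P (finRotate N i)).1 < x ∧ x < (toReal P i).1)

lemma mem_crossing {x : ℝ} {i : Fin N} : i ∈ crossing P x ↔
    ((toReal P i).1 < x ∧ x < (toReal P (finRotate N i)).1) ∨
    ((toReal P (finRotate N i)).1 < x ∧ x < (toReal P i).1) := by
  simp [crossing]

lemma dir_fst_ne_zero {x : ℝ} {i : Fin N} (h : i ∈ crossing P x) : (dir P i).1 ≠ 0 := by
  rw [mem_crossing] at h
  rw [dir, Prod.fst_sub]
  rcases h with h | h
  · exact (sub_pos.2 (lt_trans h.1 h.2)).ne'
  · exact (sub_neg.2 (lt_trans h.1 h.2)).ne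

lemma height_mem {x : ℝ} {i : Fin N} (h : i ∈ crossing P x) :
    (x, height P x i) ∈ openSegment ℝ (toReal P i) (toReal P (finRotate N i)) := by
  have hD := dir_fst_ne_zero h
  rw [mem_crossing] at h
  have hb : 0 < (x - (toReal P i).1) / (dir P i).1 ∧ (x - (toReal P i).1) / (dir P i).1 < 1 := by
    rw [dir, Prod.fst_sub]
    rcases h with h | h
    · have : 0 < (toReal P (finRotate N i)).1 - (toReal P i).1 := by linarith
      exact ⟨div_pos (by linarith) this, by rw [div_lt_one this]; linarith⟩
    · have : (toReal P (finRotate N i)).1 - (toReal P i).1 < 0 := by linarith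
      exact ⟨div_pos_of_neg_of_neg (by linarith) this, by rw [div_lt_one_of_neg this]; linarith⟩
  refine ⟨1 - (x - (toReal P i).1) / (dir P i).1, (x - (toReal P i).1) / (dir P i).1,
    by linarith, hb.1, by ring, ?_⟩
  ext
  · simp only [Prod.fst_add, Prod.smul_fst, smul_eq_mul]
    have h1 : (toReal P (finRotate N i)).1 = (toReal P i).1 + (dir P i).1 := by simp [dir]
    rw [h1]
    field_simp
    ring
  · simp only [Prod.snd_add, Prod.smul_snd, smul_eq_mul, height]
    have h1 : (toReal P (finRotate N i)).2 = (toReal P i).2 + (dir P i).2 := by simp [dir]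
    rw [h1]
    ring

/-- A vertical line through no listed point meets sides only in their interiors and meets no
vertical side. -/
lemma eq_height_of_mem {x y : ℝ} (hx : ∀ i, (toReal P i).1 ≠ x) {i : Fin N}
    (h : (x, y) ∈ segment ℝ (toReal P i) (toReal P (finRotate N i))) :
    i ∈ crossing P x ∧ y = height P x i := by
  obtain ⟨a, b, ha, hb, hab, he⟩ := h
  have h1 : a * (toReal P i).1 + b * (toReal P (finRotate N i)).1 = x := by
    simpa using congrArg Prod.fst he
  have h2 : a * (toReal P i).2 + b * (toReal P (finRotate N i)).2 = y := by
    simpa using congrArg Prod.snd he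
  have hx1 := hx i
  have hx2 := hx (finRotate N i)
  obtain rfl : a = 1 - b := by linarith
  have hb0 : 0 < b := lt_of_le_of_ne hb (by rintro rfl; exact hx1 (by linarith))
  have ha0 : 0 < 1 - b := lt_of_le_of_ne ha (fun h => hx2 (by
    obtain rfl : b = 1 := by linarith
    linarith))
  have hc : i ∈ crossing P x := by
    rw [mem_crossing]
    rcases lt_trichotomy (toReal P i).1 (toReal P (finRotate N i)).1 with h | h | h
    · left; constructor <;> nlinarith
    · exact absurd (by rw [← h1, ← h]; ring) hx1
    · right; constructor <;> nlinarith
  refine ⟨hc, ?_⟩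
  have hD := dir_fst_ne_zero hc
  have e1 : (toReal P (finRotate N i)).1 = (toReal P i).1 + (dir P i).1 := by simp [dir]
  have e2 : (toReal P (finRotate N i)).2 = (toReal P i).2 + (dir P i).2 := by simp [dir]
  rw [e1] at h1
  rw [e2] at h2
  have : (x - (toReal P i).1) / (dir P i).1 = b := by
    rw [div_eq_iff hD]; linarith
  rw [height, this]
  linarith

lemma eventually_left_enclosed (hP : IsJordan P) (hccw : IsCounterclockwise P) {i : Fin N}
    {z n : ℝ × ℝ} (hz : z ∈ openSegment ℝ (toReal P i) (toReal P (finRotate N i)))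
    (hn : 0 < cross (dir P i) n) : ∀ᶠ ε in 𝓝[>] (0 : ℝ), z + ε • n ∈ enclosed P :=
  hP.eventually_enclosed i hz hz (mul_pos (cross_turnLeft_self_pos (hP.dir_ne_zero i)) hn)
    (hccw i z hz).frequently

/-- Looking from above at the highest side over `x` shows that points to the right of the sides
are not enclosed. -/
lemma not_rightEnclosed (hP : IsJordan P) (hccw : IsCounterclockwise P) {x : ℝ}
    (hx : ∀ i, (toReal P i).1 ≠ x) (hne : (crossing P x).Nonempty) (i : Fin N) :
    ¬ RightEnclosed P i := by
  intro hi
  obtain ⟨j, hj, hmax⟩ := (crossing P x).exists_max_image (height P x) hne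
  have htop : ∀ y, height P x j < y → (x, y) ∉ enclosed P := by
    intro y hy
    refine not_mem_enclosed_of_unbounded (T := {x} ×ˢ Set.Ioi (height P x j))
      (isPreconnected_singleton.prod isPreconnected_Ioi) ?_ ?_ ⟨rfl, hy⟩
    · rintro ⟨x', y'⟩ ⟨hx', hy'⟩ hB
      obtain rfl : x' = x := hx'
      obtain ⟨k, hk⟩ := mem_boundary.1 hB
      obtain ⟨hk1, rfl⟩ := eq_height_of_mem hx hk
      exact absurd (hmax k hk1) (not_le.2 hy')
    · intro hb
      obtain ⟨C, hC⟩ := hb.exists_norm_le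
      have h1 := hC (x, max C (height P x j) + 1)
        ⟨rfl, by rw [Set.mem_Ioi]; linarith [le_max_right C (height P x j)]⟩
      have h2 := (norm_snd_le (x, max C (height P x j) + 1)).trans h1
      have h3 := (Real.le_norm_self _).trans h2
      simp only at h3
      linarith [le_max_left C (height P x j)]
  -- Upwards is to the left of a side running rightwards and to the right of one running leftwards;
  -- under the assumption both are enclosed.
  have hup : ∀ᶠ ε in 𝓝[>] (0 : ℝ), (x, height P x j) + ε • ((0, 1) : ℝ × ℝ) ∈ enclosed P := by
    rcases lt_or_gt_of_ne (dir_fst_ne_zero hj) with h | h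
    · exact hP.rightEnclosed_all hi j _ (height_mem hj) _ (by simpa [cross] using h)
    · exact eventually_left_enclosed hP hccw (height_mem hj) (by simpa [cross] using h)
  obtain ⟨ε, h1, h2⟩ := (hup.and self_mem_nhdsWithin).exists
  refine htop (height P x j + ε) (by simpa using h2) ?_
  simpa using h1

/-- The sign of the horizontal component of a side. -/
noncomputable def sgn (P : Polygon (ℤ × ℤ) N) (i : Fin N) : ℝ := if 0 < (dir P i).1 then 1 else -1

lemma isStepSet_slice (hP : IsJordan P) (hccw : IsCounterclockwise P) {x : ℝ}
    (hx : ∀ i, (toReal P i).1 ≠ x) :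
    IsStepSet (Prod.mk x ⁻¹' enclosed P) (crossing P x) (height P x) (sgn P) where
  injOn := by
    intro i hi j hj he
    by_contra hij
    refine Set.disjoint_left.1 (hP.disjoint i j hij) (height_mem hi) ?_
    have := height_mem (P := P) (Finset.mem_coe.1 hj)
    rwa [← show height P x i = height P x j from he] at this
  const := by
    intro a b hab h
    have hT : IsPreconnected (({x} : Set ℝ) ×ˢ Set.Icc a b) :=
      isPreconnected_singleton.prod isPreconnected_Icc
    have hTB : ∀ z ∈ ({x} : Set ℝ) ×ˢ Set.Icc a b, z ∉ (toReal P).boundary ℝ := by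
      rintro ⟨x', y'⟩ ⟨hx', hy'⟩ hB
      obtain rfl : x' = x := hx'
      obtain ⟨k, hk⟩ := mem_boundary.1 hB
      obtain ⟨hk1, rfl⟩ := eq_height_of_mem hx hk
      exact h k hk1 hy'
    have ha : (x, a) ∈ ({x} : Set ℝ) ×ˢ Set.Icc a b := ⟨rfl, le_rfl, hab⟩
    have hb : (x, b) ∈ ({x} : Set ℝ) ×ˢ Set.Icc a b := ⟨rfl, hab, le_rfl⟩
    exact ⟨fun h => IsPreconnected.subset_enclosed hT hTB ha h hb,
      fun h => IsPreconnected.subset_enclosed hT hTB hb h ha⟩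
  jump := by
    intro i hi
    have hz := height_mem hi
    have hR : ∀ n, cross (dir P i) n < 0 →
        ∀ᶠ ε in 𝓝[>] (0 : ℝ), (x, height P x i) + ε • n ∉ enclosed P := by
      intro n hn
      rw [← Filter.not_frequently]
      exact fun hf => not_rightEnclosed hP hccw hx ⟨i, hi⟩ i
        (hP.rightEnclosed_of_frequently hz hn hf)
    have e1 : ∀ ε : ℝ, (x, height P x i) + ε • ((0, 1) : ℝ × ℝ) = (x, height P x i + ε) := by
      intro ε; simp
    have e2 : ∀ ε : ℝ, (x, height P x i) + ε • ((0, -1) : ℝ × ℝ) = (x, height P x i - ε) := by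
      intro ε; simp [sub_eq_add_neg]
    rcases lt_or_gt_of_ne (dir_fst_ne_zero hi) with h | h
    · refine .inr ⟨by simp [sgn, h.le], ?_⟩
      have h1 := hR (0, 1) (by simpa [cross] using h)
      have h2 := eventually_left_enclosed hP hccw hz (n := (0, -1)) (by simpa [cross] using h)
      simp only [e1] at h1
      simp only [e2] at h2
      exact h1.and h2
    · refine .inl ⟨by simp [sgn, h], ?_⟩
      have h1 := hR (0, -1) (by simpa [cross] using h)
      have h2 := eventually_left_enclosed hP hccw hz (n := (0, 1)) (by simpa [cross] using h)
      simp only [e2] at h1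
      simp only [e1] at h2
      exact h2.and h1
  bounded := by
    obtain ⟨K, -, -, hK⟩ := exists_norm_bound P
    refine ⟨-K, fun t ht htE => ?_⟩
    have h1 := (norm_snd_le (x, t)).trans (hK _ htE)
    have h2 := (neg_le_abs _).trans h1
    simp only at h2
    linarith

lemma slice_volume (hP : IsJordan P) (hccw : IsCounterclockwise P) {M : ℝ}
    (hB : ∀ z ∈ (toReal P).boundary ℝ, ‖z‖ ≤ M) (hE : ∀ z ∈ enclosed P, ‖z‖ ≤ M) {x : ℝ}
    (hx : ∀ i, (toReal P i).1 ≠ x) :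
    volume.real (Prod.mk x ⁻¹' region P) =
      ∑ i ∈ crossing P x, sgn P i * (M - height P x i) := by
  rw [← (isStepSet_slice hP hccw hx).volume_eq]
  · refine measureReal_congr ?_
    have hfin : (height P x '' (crossing P x : Set (Fin N))).Finite :=
      (crossing P x).finite_toSet.image _
    rw [Filter.eventuallyEq_set]
    filter_upwards [hfin.countable.ae_notMem volume] with y hy
    simp only [region, Set.mem_preimage, Set.mem_union]
    refine or_iff_right fun hB => ?_
    obtain ⟨k, hk⟩ := mem_boundary.1 hB
    obtain ⟨hk1, rfl⟩ := eq_height_of_mem hx hk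
    exact hy ⟨k, hk1, rfl⟩
  · exact (isOpen_enclosed P).measurableSet.preimage measurable_prodMk_left
  · intro y hy
    exact abs_le.1 ((norm_snd_le (x, y)).trans (hE _ hy))
  · intro i hi
    exact abs_le.1 ((norm_snd_le (x, height P x i)).trans (hB _ (mem_boundary.2
      ⟨i, openSegment_subset_segment _ _ _ (height_mem hi)⟩)))

/-! ### Integration over the slices -/

lemma region_subset_closedBall : ∃ M, region P ⊆ Metric.closedBall 0 M := by
  obtain ⟨K, -, h1, h2⟩ := exists_norm_bound P
  refine ⟨K, fun z hz => ?_⟩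
  rw [mem_closedBall_zero_iff]
  exact hz.elim (h1 z) (h2 z)

lemma volume_region_lt_top (P : Polygon (ℤ × ℤ) N) : volume (region P) < ⊤ := by
  obtain ⟨M, hM⟩ := region_subset_closedBall (P := P)
  exact (measure_mono hM).trans_lt measure_closedBall_lt_top

lemma volume_region_eq_integral (P : Polygon (ℤ × ℤ) N) :
    volume.real (region P) = ∫ x, volume.real (Prod.mk x ⁻¹' region P) := by
  have hm := measurableSet_region P
  have hfin := volume_region_lt_top P
  rw [measureReal_def, Measure.volume_eq_prod] at *
  simp only [measureReal_def]
  rw [integral_toReal (measurable_measure_prodMk_left hm).aemeasurable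
    (Measure.ae_measure_lt_top hm hfin.ne), Measure.prod_apply hm]

lemma integrableOn_height (P : Polygon (ℤ × ℤ) N) (c M : ℝ) (i : Fin N) (a b : ℝ) :
    IntegrableOn (fun x => c * (M - height P x i)) (Set.Ioo a b) := by
  refine (Continuous.integrableOn_Icc ?_).mono_set Set.Ioo_subset_Icc_self
  unfold height
  fun_prop

lemma crossing_term_eq (M : ℝ) (i : Fin N) :
    (fun x => if i ∈ crossing P x then sgn P i * (M - height P x i) else 0) =
      (Set.Ioo (min (toReal P i).1 (toReal P (finRotate N i)).1)
        (max (toReal P i).1 (toReal P (finRotate N i)).1)).indicator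
        fun x => sgn P i * (M - height P x i) := by
  ext x
  rw [Set.indicator_apply]
  congr 1
  rw [mem_crossing, Set.mem_Ioo, min_lt_iff, lt_max_iff, eq_iff_iff]
  constructor
  · rintro (h | h)
    · exact ⟨.inl h.1, .inr h.2⟩
    · exact ⟨.inr h.1, .inl h.2⟩
  · rintro ⟨h1 | h1, h2 | h2⟩
    · exact absurd h1 h2.le.not_gt
    · exact .inl ⟨h1, h2⟩
    · exact .inr ⟨h1, h2⟩
    · exact absurd h1 h2.le.not_gt

/-- This is the signed trapezoid between the side and the level `M`; `sgn` is absorbed by the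
orientation of the interval integral. -/
lemma integral_crossing_term (M : ℝ) (i : Fin N) :
    ∫ x, (if i ∈ crossing P x then sgn P i * (M - height P x i) else 0) =
      (dir P i).1 * M -
        (dir P i).1 * ((toReal P i).2 + (toReal P (finRotate N i)).2) / 2 := by
  rw [crossing_term_eq, integral_indicator measurableSet_Ioo, ← integral_Ioc_eq_integral_Ioo]
  have h1 : (toReal P (finRotate N i)).1 = (toReal P i).1 + (dir P i).1 := by simp [dir]
  have h2 : (toReal P (finRotate N i)).2 = (toReal P i).2 + (dir P i).2 := by simp [dir]
  have key : ∫ x in (toReal P i).1..(toReal P (finRotate N i)).1, (M - height P x i) =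
      (dir P i).1 * M - (dir P i).1 * ((toReal P i).2 + (toReal P (finRotate N i)).2) / 2 := by
    rw [h1, h2]
    -- For a vertical side `height` divides by zero, but the interval of integration is degenerate.
    rcases eq_or_ne (dir P i).1 0 with h0 | h0
    · simp [h0]
    · have : (fun x => M - height P x i) = fun x =>
          (M - (toReal P i).2 + (toReal P i).1 * ((dir P i).2 / (dir P i).1)) -
            ((dir P i).2 / (dir P i).1) * x := by
        ext x; rw [height]; ring
      rw [this, intervalIntegral.integral_sub (by simp)
        (Continuous.intervalIntegrable (by fun_prop) _ _)]
      rw [intervalIntegral.integral_const, intervalIntegral.integral_const_mul, integral_id]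
      simp only [smul_eq_mul]
      field_simp
      ring
  rw [← key]
  rcases lt_or_ge 0 (dir P i).1 with h | h
  · have hle : (toReal P i).1 ≤ (toReal P (finRotate N i)).1 := by linarith
    rw [min_eq_left hle, max_eq_right hle, intervalIntegral.integral_of_le hle]
    simp [sgn, h]
  · have hle : (toReal P (finRotate N i)).1 ≤ (toReal P i).1 := by linarith
    rw [min_eq_right hle, max_eq_left hle, intervalIntegral.integral_of_ge hle,
      ← integral_neg]
    simp [sgn, h.not_gt]

lemma volume_region (hP : IsJordan P) (hccw : IsCounterclockwise P) :
    volume.real (region P) = 1 / 2 * (surveyorSum P : ℝ) := by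
  obtain ⟨M, -, hB, hE⟩ := exists_norm_bound P
  have hae : ∀ᵐ x : ℝ, volume.real (Prod.mk x ⁻¹' region P) =
      ∑ i, if i ∈ crossing P x then sgn P i * (M - height P x i) else 0 := by
    filter_upwards [(Set.finite_range fun i => (toReal P i).1).countable.ae_notMem volume]
      with x hx
    rw [slice_volume hP hccw hB hE fun i hi => hx ⟨i, hi⟩, Finset.sum_ite_mem, Finset.univ_inter]
  rw [volume_region_eq_integral, integral_congr_ae hae, integral_finsetSum]
  · simp only [integral_crossing_term]
    -- A trapezoid differs from half the determinant by the increments of `x * M` and `x * y / 2`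
    -- along the side; both sum to zero around the cycle.
    have h1 := Equiv.sum_comp (finRotate N) fun i => (toReal P i).1 * M
    have h2 := Equiv.sum_comp (finRotate N) fun i => (toReal P i).1 * (toReal P i).2 / 2
    have h3 : (surveyorSum P : ℝ) = ∑ i, ((toReal P i).1 * (toReal P (finRotate N i)).2 -
        (toReal P i).2 * (toReal P (finRotate N i)).1) := by
      simp only [surveyorSum, Matrix.det_fin_two_of]
      push_cast
      rfl
    rw [h3, Finset.mul_sum, ← sub_eq_zero, ← Finset.sum_sub_distrib]
    rw [← sub_eq_zero, ← Finset.sum_sub_distrib] at h1 h2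
    have h4 := congrArg₂ (· - ·) h1 h2
    simp only [← Finset.sum_sub_distrib, sub_zero] at h4
    rw [← h4]
    refine Finset.sum_congr rfl fun i _ => ?_
    simp only [dir, Prod.fst_sub]
    ring
  · intro i _
    rw [crossing_term_eq]
    exact (integrable_indicator_iff measurableSet_Ioo).2 (integrableOn_height P _ M i _ _)

/-! ### Deleting points that are not vertices -/

/-- The determinant of two integer vectors. -/
def intCross (u v : ℤ × ℤ) : ℤ := u.1 * v.2 - u.2 * v.1

lemma intCross_eq_zero_of_sameRay {u v : ℤ × ℤ} (h : SameRay ℤ u v) : intCross u v = 0 := by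
  rcases h with rfl | rfl | ⟨r, r', hr, -, h⟩
  · simp [intCross]
  · simp [intCross]
  · have h1 : r * u.1 = r' * v.1 := by simpa using congrArg Prod.fst h
    have h2 : r * u.2 = r' * v.2 := by simpa using congrArg Prod.snd h
    refine (mul_eq_zero.1 (?_ : r * intCross u v = 0)).resolve_left hr.ne'
    rw [intCross]
    linear_combination v.2 * h1 - v.1 * h2

lemma intCross_trans {u v w : ℤ × ℤ} (hv : v ≠ 0) (h : intCross u v = 0)
    (h' : intCross v w = 0) : intCross u w = 0 := by
  simp only [intCross] at *
  rcases eq_or_ne v.1 0 with h1 | h1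
  · have h2 : v.2 ≠ 0 := fun h2 => hv (Prod.ext h1 h2)
    refine (mul_eq_zero.1 (?_ : v.2 * _ = 0)).resolve_left h2
    linear_combination w.2 * h + u.2 * h'
  · refine (mul_eq_zero.1 (?_ : v.1 * _ = 0)).resolve_left h1
    linear_combination u.1 * h' + w.1 * h

/-- Along a stretch of parallel steps the determinants add up to that of the two ends. -/
lemma sum_intCross_of_parallel {p : ℕ → ℤ × ℤ} (hp : ∀ t, p (t + 1) - p t ≠ 0) {a b : ℕ}
    (hab : a ≤ b)
    (h : ∀ t, a ≤ t → t + 1 < b → intCross (p (t + 1) - p t) (p (t + 2) - p (t + 1)) = 0) :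
    ∑ t ∈ Finset.Ico a b, intCross (p t) (p (t + 1)) = intCross (p a) (p b) := by
  have hd : ∀ t, a ≤ t → t < b → intCross (p (a + 1) - p a) (p (t + 1) - p t) = 0 := by
    intro t hat
    induction t, hat using Nat.le_induction with
    | base => intro _; simp only [intCross]; ring
    | succ t hat ih => exact fun htb => intCross_trans (hp t) (ih (by omega)) (h t hat htb)
  have hD : ∀ t, a ≤ t → t ≤ b → intCross (p (a + 1) - p a) (p t - p a) = 0 := by
    intro t hat
    induction t, hat using Nat.le_induction with
    | base => intro _; simp [intCross]
    | succ t hat ih =>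
      intro htb
      have h1 := ih (by omega)
      have h2 := hd t hat (by omega)
      simp only [intCross, Prod.fst_sub, Prod.snd_sub] at *
      linear_combination h1 + h2
  have main : ∀ t, a ≤ t → t ≤ b →
      ∑ k ∈ Finset.Ico a t, intCross (p k) (p (k + 1)) = intCross (p a) (p t) := by
    intro t hat
    induction t, hat using Nat.le_induction with
    | base => intro _; simp [intCross, mul_comm]
    | succ t hat ih =>
      intro htb
      rw [Finset.sum_Ico_succ_top hat, ih (by omega)]
      have h1 := hD t hat (by omega)
      have h2 : intCross (p t - p a) (p (a + 1) - p a) = 0 := by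
        simp only [intCross] at h1 ⊢
        linear_combination -h1
      -- The points `p a`, `p t`, `p (t + 1)` are collinear, so the triangle they span adds nothing.
      have h3 := intCross_trans (hp a) h2 (hd t hat (by omega))
      simp only [intCross, Prod.fst_sub, Prod.snd_sub] at h3 ⊢
      linear_combination h3
  exact main b hab le_rfl

lemma val_finRotate {n : ℕ} (i : Fin n) : (finRotate n i : ℕ) = (i + 1) % n := by
  obtain _ | n := n
  · exact i.elim0
  · rw [coe_finRotate]
    split_ifs with h
    · simp [h]
    · rw [Nat.mod_eq_of_lt]
      have : (i : ℕ) ≠ n := fun h' => h (Fin.ext h')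
      omega

/-- The points of a polygon as a periodic sequence. -/
def periodicPoint [NeZero N] (P : Polygon (ℤ × ℤ) N) (t : ℕ) : ℤ × ℤ := P (Fin.ofNat N t)

lemma finRotate_ofNat [NeZero N] (t : ℕ) :
    finRotate N (Fin.ofNat N t) = Fin.ofNat N (t + 1) := by
  ext
  rw [val_finRotate]
  exact Nat.mod_add_mod t N 1

lemma ofNat_val [NeZero N] (i : Fin N) : Fin.ofNat N i = i := by
  ext
  simp

lemma periodicPoint_add [NeZero N] (P : Polygon (ℤ × ℤ) N) (t : ℕ) :
    periodicPoint P (t + N) = periodicPoint P t := by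
  rw [periodicPoint, periodicPoint]
  congr 1
  ext
  simp

lemma IsJordan.periodicPoint_ne [NeZero N] (hP : IsJordan P) (t : ℕ) :
    periodicPoint P (t + 1) - periodicPoint P t ≠ 0 := by
  rw [periodicPoint, periodicPoint, ← finRotate_ofNat, sub_ne_zero]
  exact (hP.simple _).1.symm

lemma intCross_periodicPoint [NeZero N] {t : ℕ} (h : ¬ IsVertex P (Fin.ofNat N (t + 1))) :
    intCross (periodicPoint P (t + 1) - periodicPoint P t)
      (periodicPoint P (t + 2) - periodicPoint P (t + 1)) = 0 := by
  have h1 : (finRotate N).symm (Fin.ofNat N (t + 1)) = Fin.ofNat N t := by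
    rw [Equiv.symm_apply_eq, finRotate_ofNat]
  rw [IsVertex, not_not, h1, finRotate_ofNat] at h
  exact intCross_eq_zero_of_sameRay h

/-- The window may start anywhere by periodicity; it will start at the first kept index. -/
lemma surveyorSum_eq_sum_Ico [NeZero N] (P : Polygon (ℤ × ℤ) N) (a : ℕ) :
    surveyorSum P =
      ∑ t ∈ Finset.Ico a (a + N), intCross (periodicPoint P t) (periodicPoint P (t + 1)) := by
  induction a with
  | zero =>
    rw [zero_add, ← Finset.range_eq_Ico,
      ← Fin.sum_univ_eq_sum_range (fun t => intCross (periodicPoint P t) (periodicPoint P (t + 1)))]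
    refine Finset.sum_congr rfl fun i _ => ?_
    rw [Matrix.det_fin_two_of, intCross, periodicPoint, periodicPoint, ← finRotate_ofNat, ofNat_val]
  | succ a ih =>
    have hN : 0 < N := Nat.pos_of_ne_zero (NeZero.ne N)
    rw [ih, Finset.sum_eq_sum_Ico_succ_bot (by omega), add_right_comm a 1 N,
      Finset.sum_Ico_succ_top (by omega), add_comm, add_right_comm a N 1, periodicPoint_add,
      periodicPoint_add]

/-- The surveyor sum does not change when points that are not vertices are deleted. -/
lemma surveyorSum_restrict (hP : IsJordan P) {S : Finset (Fin N)} (hS : vertexIndices P ⊆ S) :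
    surveyorSum (restrict P S) = surveyorSum P := by
  have : NeZero N := ⟨by have := hP.three_le; omega⟩
  have hnv : ∀ t, Fin.ofNat N t ∉ S → ¬ IsVertex P (Fin.ofNat N t) := fun t ht hv =>
    ht (hS (by simpa [vertexIndices] using hv))
  rcases S.eq_empty_or_nonempty with rfl | hne
  -- With nothing kept, the whole closed path is one parallel stretch, whose sum is the determinant
  -- of a point with itself.
  · have h := sum_intCross_of_parallel hP.periodicPoint_ne (Nat.zero_le (0 + N)) fun t _ _ =>
      intCross_periodicPoint (hnv (t + 1) (by simp))
    rw [← surveyorSum_eq_sum_Ico, periodicPoint_add] at h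
    rw [h, surveyorSum, intCross, mul_comm, sub_self]
    exact Finset.sum_of_isEmpty (ι := Fin 0) _
  have hk : 0 < S.card := hne.card_pos
  set k := S.card with hkdef
  set e := S.orderEmbOfFin hkdef.symm with he
  -- The kept indices in order, closed up by the first one shifted by `N`, so that the stretches
  -- from `σ j` to `σ (j + 1)` tile one full period.
  set σ : ℕ → ℕ := fun j => if h : j < k then e ⟨j, h⟩ else e ⟨0, hk⟩ + N with hσ
  have hσlt : ∀ (j : ℕ) (h : j < k), σ j = e ⟨j, h⟩ := fun j h => dif_pos h
  have hσk : σ k = e ⟨0, hk⟩ + N := dif_neg (lt_irrefl k)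
  have hmem : ∀ i ∈ S, ∃ l, e l = i := by
    intro i hi
    have : i ∈ Set.range e := by rw [he, Finset.range_orderEmbOfFin]; exact hi
    exact this
  have hmono : ∀ j, j < k → σ j < σ (j + 1) := by
    intro j hj
    rw [hσlt j hj]
    rcases Nat.lt_or_ge (j + 1) k with h | h
    · rw [hσlt _ h]
      exact e.strictMono (by simp)
    · have hkj : k = j + 1 := by omega
      rw [← hkj, hσk]
      have := (e ⟨j, hj⟩).2
      omega
  have hgap : ∀ j, j < k → ∀ t, σ j < t → t < σ (j + 1) → Fin.ofNat N t ∉ S := by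
    intro j hj t h1 h2 hmemS
    obtain ⟨l, hl⟩ := hmem _ hmemS
    have hlv : (e l : ℕ) = t % N := by rw [hl]; rfl
    rw [hσlt j hj] at h1
    rcases Nat.lt_or_ge (j + 1) k with h | h
    · rw [hσlt _ h] at h2
      rw [Nat.mod_eq_of_lt (h2.trans (e ⟨j + 1, h⟩).2)] at hlv
      have a1 : (⟨j, hj⟩ : Fin k) < l := e.lt_iff_lt.1 (Fin.lt_def.2 (by omega))
      have a2 : l < ⟨j + 1, h⟩ := e.lt_iff_lt.1 (Fin.lt_def.2 (by omega))
      rw [Fin.lt_def] at a1 a2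
      simp only at a1 a2
      omega
    · have hkj : k = j + 1 := by omega
      rw [← hkj, hσk] at h2
      rcases Nat.lt_or_ge t N with htN | htN
      · rw [Nat.mod_eq_of_lt htN] at hlv
        have a1 : (⟨j, hj⟩ : Fin k) < l := e.lt_iff_lt.1 (Fin.lt_def.2 (by omega))
        rw [Fin.lt_def] at a1
        simp only at a1
        omega
      -- Past the wraparound, `t - N` would be a kept index smaller than the first.
      · have := (e ⟨0, hk⟩).2
        rw [Nat.mod_eq_sub_mod htN, Nat.mod_eq_of_lt (by omega)] at hlv
        have a1 : l < ⟨0, hk⟩ := e.lt_iff_lt.1 (Fin.lt_def.2 (by omega))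
        simp [Fin.lt_def] at a1
  have hterm : ∀ j : Fin k, Matrix.det !![(restrict P S j).1, (restrict P S j).2;
      (restrict P S (finRotate k j)).1, (restrict P S (finRotate k j)).2] =
      intCross (periodicPoint P (σ j)) (periodicPoint P (σ (j + 1))) := by
    intro j
    have e1 : periodicPoint P (σ j) = P (e j) := by
      rw [hσlt j j.2, periodicPoint, ofNat_val]
    have e2 : periodicPoint P (σ (j + 1)) = P (e (finRotate k j)) := by
      rcases Nat.lt_or_ge (j + 1) k with h | h
      · rw [hσlt _ h, periodicPoint, ofNat_val]
        congr 2
        ext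
        rw [val_finRotate, Nat.mod_eq_of_lt h]
      · have hjk : (j : ℕ) + 1 = k := by omega
        rw [hjk, hσk, periodicPoint_add, periodicPoint, ofNat_val]
        congr 2
        ext
        rw [val_finRotate, hjk, Nat.mod_self]
    rw [e1, e2, Matrix.det_fin_two_of]
    rfl
  set g : ℕ → ℤ := fun t => intCross (periodicPoint P t) (periodicPoint P (t + 1)) with hg
  have hstep : ∀ j, j < k → intCross (periodicPoint P (σ j)) (periodicPoint P (σ (j + 1))) =
      ∑ t ∈ Finset.range (σ (j + 1)), g t - ∑ t ∈ Finset.range (σ j), g t := by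
    intro j hj
    rw [← Finset.sum_Ico_eq_sub _ (hmono j hj).le]
    exact (sum_intCross_of_parallel hP.periodicPoint_ne (hmono j hj).le fun t h1 h2 =>
      intCross_periodicPoint (hnv _ (hgap j hj _ (by omega) h2))).symm
  rw [surveyorSum_eq_sum_Ico P (e ⟨0, hk⟩), Finset.sum_Ico_eq_sub _ (Nat.le_add_right _ _),
    ← hσk, ← hσlt 0 hk, ← Finset.sum_range_sub (fun j => ∑ t ∈ Finset.range (σ j), g t),
    surveyorSum, Finset.sum_congr rfl fun j _ => hterm j,
    Fin.sum_univ_eq_sum_range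
      (fun j => intCross (periodicPoint P (σ j)) (periodicPoint P (σ (j + 1))))]
  exact Finset.sum_congr rfl fun j hj => hstep j (Finset.mem_range.1 hj)

end LatticePolygon

theorem mainTheorem3 {N : ℕ} (P : Polygon (ℤ × ℤ) N)
    (hP : LatticePolygon.IsJordan P) (hccw : LatticePolygon.IsCounterclockwise P) :
    volume (LatticePolygon.region P) < ⊤ ∧
    volume.real (LatticePolygon.region P) = 1 / 2 * (LatticePolygon.surveyorSum P : ℝ) ∧
    (∀ S : Finset (Fin N), LatticePolygon.vertexIndices P ⊆ S →
      volume.real (LatticePolygon.region P) =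
        1 / 2 * (LatticePolygon.surveyorSum (LatticePolygon.restrict P S) : ℝ)) ∧
    volume.real (LatticePolygon.region P) =
      1 / 2 * (LatticePolygon.surveyorSum
        (LatticePolygon.restrict P (LatticePolygon.vertexIndices P)) : ℝ) := by
  have hA := LatticePolygon.volume_region hP hccw
  refine ⟨LatticePolygon.volume_region_lt_top P, hA, fun S hS => ?_, ?_⟩
  · rw [LatticePolygon.surveyorSum_restrict hP hS, hA]
  · rw [LatticePolygon.surveyorSum_restrict hP subset_rfl, hA]
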